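/- Let $d\in\mathbb N$, let $u_1,u_2$ be hermitian complex $d\times d$ matrices, and let $$W=W(u_1,u_2)=\{(x^*u_1x,\;x^*u_2x)\mid x\in\mathbb C^d,\ x^*x=1\}\subset\mathbb R^2$$ be their joint numerical range (a compact convex set). We use the following notions. - A *face* of $W$ is a convex subset $F\subset W$ which contains every segment in $W$ that meets $F$ in an interior point of the segment; a *facet* is a non-empty face of dimension $\dim W-1$. - A *supporting line* of $W$ is a line in $\mathbb R^2$ that meets $W$ and has $W$ in one of its two closed half-planes ($W$ may be contained in the line). A *corner point* of $W$ is a point of $W$ that belongs to more than one supporting line of $W$. - A *flat boundary portion* of $W$ is a non-trivial line segment contained in the boundary of $W$ in $\mathbb R^2$. A *round boundary point* of $W$ is a boundary point of $W$ (in $\mathbb R^2$) that is not a corner point and does not belong to the relative interior of a flat boundary portion. - A point $x\in W$ is a *simplicial point* of $W$ if there are finitely many simplices $S_1,\dots,S_m\subset W$ such that $S_1\cup\dots\cup S_m$ is a neighborhood of $x$ in $W$. Then: 1. If $\dim W=2$, then for every corner point $x$ of $W$ there are two distinct facets $F_1,F_2$ of $W$ with $F_1\cap F_2=\{x\}$.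 2. Without any restriction on $\dim W$, every point of $W$ is either a round boundary point of $W$ or a simplicial point of $W$, but not both. -/

import Mathlib

open scoped Matrix Topology

/-- The joint numerical range `{(x* u₁ x, …, x* u_r x) | x ∈ ℂ^d, x* x = 1} ⊆ ℝ^r` of a tuple of
(hermitian) matrices; the numbers `x* u_i x` are real when the `u_i` are hermitian. -/
def jointNumericalRange {d r : ℕ} (u : Fin r → Matrix (Fin d) (Fin d) ℂ) :
    Set (EuclideanSpace ℝ (Fin r)) :=
  {w | ∃ x : Fin d → ℂ, star x ⬝ᵥ x = 1 ∧ ∀ i, ((w i : ℝ) : ℂ) = star x ⬝ᵥ (u i *ᵥ x)}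

/-- The dimension of (the affine hull of) a non-empty subset of `ℝ^r`. -/
noncomputable def affineDim {r : ℕ} (C : Set (EuclideanSpace ℝ (Fin r))) : ℕ :=
  Module.finrank ℝ (vectorSpan ℝ C)

/-- A face of `C`: a convex subset which contains every segment of `C` that it meets in an
interior point of that segment. -/
def IsConvexFace {r : ℕ} (C F : Set (EuclideanSpace ℝ (Fin r))) : Prop :=
  Convex ℝ F ∧ IsExtreme ℝ C F

/-- A facet of `C`: a non-empty face of codimension one. -/
def IsFacet {r : ℕ} (C F : Set (EuclideanSpace ℝ (Fin r))) : Prop :=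
  IsConvexFace C F ∧ F.Nonempty ∧ affineDim F + 1 = affineDim C

/-- `x` is a simplicial point of `C`: finitely many simplices contained in `C` (of any dimensions,
including single points) have a union that is a neighborhood of `x` in `C`. -/
def IsSimplicialPoint {r : ℕ} (C : Set (EuclideanSpace ℝ (Fin r)))
    (x : EuclideanSpace ℝ (Fin r)) : Prop :=
  x ∈ C ∧ ∃ (m : ℕ) (k : Fin m → ℕ)
    (S : (j : Fin m) → Affine.Simplex ℝ (EuclideanSpace ℝ (Fin r)) (k j)),
      (∀ j, convexHull ℝ (Set.range (S j).points) ⊆ C) ∧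
      (⋃ j, convexHull ℝ (Set.range (S j).points)) ∈ 𝓝[C] x

/-- A supporting line of `C ⊆ ℝ²`: a line that meets `C` and has `C` in one of its two closed
half-planes (`C` may lie in the line). -/
def IsSupportingLine (C l : Set (EuclideanSpace ℝ (Fin 2))) : Prop :=
  ∃ (v : EuclideanSpace ℝ (Fin 2)) (c : ℝ), v ≠ 0 ∧ l = {y | inner ℝ v y = c} ∧
    (l ∩ C).Nonempty ∧ ∀ y ∈ C, inner ℝ v y ≤ c

/-- A corner point of `C ⊆ ℝ²`: a point of `C` on more than one supporting line of `C`. -/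
def IsCornerPoint (C : Set (EuclideanSpace ℝ (Fin 2))) (x : EuclideanSpace ℝ (Fin 2)) : Prop :=
  x ∈ C ∧ ∃ l₁ l₂ : Set (EuclideanSpace ℝ (Fin 2)),
    IsSupportingLine C l₁ ∧ IsSupportingLine C l₂ ∧ x ∈ l₁ ∧ x ∈ l₂ ∧ l₁ ≠ l₂

/-- A flat boundary portion of `C ⊆ ℝ²`: a non-trivial segment in the (topological) boundary. -/
def IsFlatBoundaryPortion (C S : Set (EuclideanSpace ℝ (Fin 2))) : Prop :=
  ∃ a b : EuclideanSpace ℝ (Fin 2), a ≠ b ∧ S = segment ℝ a b ∧ S ⊆ frontier C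

/-- A round boundary point of `C ⊆ ℝ²`: a boundary point that is not a corner point and does not
lie in the relative interior of a flat boundary portion. -/
def IsRoundBoundaryPoint (C : Set (EuclideanSpace ℝ (Fin 2)))
    (x : EuclideanSpace ℝ (Fin 2)) : Prop :=
  x ∈ frontier C ∧ ¬ IsCornerPoint C x ∧
    ¬ ∃ S, IsFlatBoundaryPortion C S ∧ x ∈ intrinsicInterior ℝ S

/-! Let `W` be the numerical range; it is compact, and convex by Toeplitz–Hausdorff. Everything
rests on the shape of `W` at a corner point `c`. Two independent functionals attain their maximum
over `W` at `c`, so a unit vector with value `c` is an eigenvector of two independent combinations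
of the matrices, hence a common eigenvector. Splitting the space into the common eigenspace `K` for
`c` and its orthogonal complement removes the cross terms, so every point of `W` other than `c` lies
on a ray from `c` through the set `V` of values of unit vectors in `Kᗮ`. `V` is compact and misses
`c` (`exists_isCompact_cone_of_corner`). If `dim W = 2`, the extreme slopes of `V` seen from `c` are
attained, at `p` and `q` say, and `W` lies in the angle at `c` spanned by `p` and `q`
(`exists_isCoordinates_of_cone`). The two sides of the angle cut out the facets, and the triangle `c
p q` is a neighborhood of `c` in `W`. The dichotomy is then planar convexity. Interior points,
corners and relative interiors of flat portions have triangular neighborhoods in `W`, and if `dim W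
≤ 1` then `W` is a point or a segment. Conversely, near a simplicial boundary point finitely many
points of `W` generate the tangent cone. If the supporting line is unique, a slight tilt of it must
fail in both directions, which puts generators on the line on both sides of the point: it is inside
a flat portion, not round. -/

/-! ### Linear algebra of the plane -/

section Plane

/-- The quarter-turn of a vector of the Euclidean plane. -/
def quarterTurn (v : EuclideanSpace ℝ (Fin 2)) : EuclideanSpace ℝ (Fin 2) := !₂[-(v 1), v 0]

theorem inner_plane (v w : EuclideanSpace ℝ (Fin 2)) :
    inner ℝ v w = v 0 * w 0 + v 1 * w 1 := by
  simp [PiLp.inner_apply, Fin.sum_univ_two, mul_comm]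

theorem inner_quarterTurn_self (v : EuclideanSpace ℝ (Fin 2)) :
    inner ℝ (quarterTurn v) v = 0 := by
  simp [inner_plane, quarterTurn]; ring

theorem quarterTurn_quarterTurn (v : EuclideanSpace ℝ (Fin 2)) :
    quarterTurn (quarterTurn v) = -v := by
  ext i
  fin_cases i <;> simp [quarterTurn]

theorem plane_sq_add_sq_pos {v : EuclideanSpace ℝ (Fin 2)} (hv : v ≠ 0) :
    0 < v 0 ^ 2 + v 1 ^ 2 := by
  have h := real_inner_self_pos.2 hv
  rw [inner_plane] at h
  nlinarith

theorem quarterTurn_ne_zero {v : EuclideanSpace ℝ (Fin 2)} (hv : v ≠ 0) : quarterTurn v ≠ 0 := by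
  intro h
  have h0 := congrArg (fun w : EuclideanSpace ℝ (Fin 2) => w 0) h
  have h1 := congrArg (fun w : EuclideanSpace ℝ (Fin 2) => w 1) h
  simp [quarterTurn] at h0 h1
  have := plane_sq_add_sq_pos hv
  simp [h0, h1] at this

/-- A vector and its quarter-turn separate the vectors of the plane. -/
theorem eq_zero_of_inner_quarterTurn {v z : EuclideanSpace ℝ (Fin 2)} (hv : v ≠ 0)
    (h₁ : inner ℝ v z = 0) (h₂ : inner ℝ (quarterTurn v) z = 0) : z = 0 := by
  rw [inner_plane] at h₁ h₂
  simp [quarterTurn] at h₂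
  have hp := plane_sq_add_sq_pos hv
  have e0 : (v 0 ^ 2 + v 1 ^ 2) * z 0 = 0 := by linear_combination v 0 * h₁ - v 1 * h₂
  have e1 : (v 0 ^ 2 + v 1 ^ 2) * z 1 = 0 := by linear_combination v 1 * h₁ + v 0 * h₂
  ext i
  fin_cases i
  · simpa [hp.ne'] using e0
  · simpa [hp.ne'] using e1

/-- In the plane, vectors orthogonal to a common non-zero vector are multiples of its
quarter-turn. -/
theorem eq_smul_quarterTurn_of_inner_eq_zero {v z : EuclideanSpace ℝ (Fin 2)} (hz : z ≠ 0)
    (h : inner ℝ v z = 0) : ∃ a : ℝ, v = a • quarterTurn z := by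
  have hp := plane_sq_add_sq_pos hz
  rw [inner_plane] at h
  refine ⟨(v 1 * z 0 - v 0 * z 1) / (z 0 ^ 2 + z 1 ^ 2), ?_⟩
  ext i
  fin_cases i
  · simp [quarterTurn]
    field_simp
    linear_combination z 0 * h
  · simp [quarterTurn]
    field_simp
    linear_combination z 1 * h

end Plane

/-! ### Numerical ranges of operators and the Toeplitz–Hausdorff theorem -/

section NumericalRange

variable {F : Type*} [NormedAddCommGroup F] [InnerProductSpace ℂ F]

/-- The point of `ℝ^r` with coordinates `re ⟪A i x, x⟫`. -/
noncomputable def numericalValue {r : ℕ} (A : Fin r → F →L[ℂ] F) (x : F) :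
    EuclideanSpace ℝ (Fin r) :=
  WithLp.toLp 2 fun i => (A i).reApplyInnerSelf x

theorem numericalValue_apply {r : ℕ} (A : Fin r → F →L[ℂ] F) (x : F) (i : Fin r) :
    numericalValue A x i = (A i).reApplyInnerSelf x := rfl

theorem numericalValue_smul {r : ℕ} (A : Fin r → F →L[ℂ] F) (c : ℂ) (x : F) :
    numericalValue A (c • x) = ‖c‖ ^ 2 • numericalValue A x := by
  ext i
  simp [numericalValue_apply, ContinuousLinearMap.reApplyInnerSelf_smul]

theorem continuous_numericalValue {r : ℕ} (A : Fin r → F →L[ℂ] F) :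
    Continuous (numericalValue A) := by
  unfold numericalValue
  refine (PiLp.continuous_toLp 2 _).comp (continuous_pi fun i => ?_)
  exact (A i).reApplyInnerSelf_continuous

/-- The joint numerical range of a tuple of operators. -/
def operatorNumericalRange {r : ℕ} (A : Fin r → F →L[ℂ] F) : Set (EuclideanSpace ℝ (Fin r)) :=
  numericalValue A '' Metric.sphere 0 1

theorem isCompact_operatorNumericalRange [FiniteDimensional ℂ F] {r : ℕ}
    (A : Fin r → F →L[ℂ] F) : IsCompact (operatorNumericalRange A) := by
  have : ProperSpace F := FiniteDimensional.proper ℂ F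
  exact (isCompact_sphere 0 1).image (continuous_numericalValue A)

/-- A non-zero vector gives, after normalization, a point of the numerical range. -/
theorem inv_smul_numericalValue_mem {r : ℕ} (A : Fin r → F →L[ℂ] F) {x : F} (hx : x ≠ 0) :
    (‖x‖ ^ 2)⁻¹ • numericalValue A x ∈ operatorNumericalRange A := by
  refine ⟨((‖x‖⁻¹ : ℝ) : ℂ) • x, ?_, ?_⟩
  · simp [norm_smul, hx]
  · rw [numericalValue_smul]; simp

/-- The real linear combination of the operators `A i` with coefficients `v`. -/
noncomputable def operatorCombination {r : ℕ} (A : Fin r → F →L[ℂ] F)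
    (v : EuclideanSpace ℝ (Fin r)) : F →L[ℂ] F := ∑ i, ((v i : ℝ) : ℂ) • A i

theorem reApplyInnerSelf_operatorCombination {r : ℕ} (A : Fin r → F →L[ℂ] F)
    (v : EuclideanSpace ℝ (Fin r)) (x : F) :
    (operatorCombination A v).reApplyInnerSelf x = inner ℝ v (numericalValue A x) := by
  simp only [operatorCombination, ContinuousLinearMap.reApplyInnerSelf_apply, PiLp.inner_apply,
    numericalValue, sum_inner, sum_apply, smul_apply,
    inner_smul_left, Complex.conj_ofReal, map_sum, RCLike.re_eq_complex_re, Complex.re_ofReal_mul]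
  simp [mul_comm]

theorem isSelfAdjoint_operatorCombination [CompleteSpace F] {r : ℕ} {A : Fin r → F →L[ℂ] F}
    (hA : ∀ i, IsSelfAdjoint (A i)) (v : EuclideanSpace ℝ (Fin r)) :
    IsSelfAdjoint (operatorCombination A v) := by
  unfold operatorCombination
  refine isSelfAdjoint_sum _ fun i _ => IsSelfAdjoint.smul ?_ (hA i)
  simp [IsSelfAdjoint]

/-- Self-adjointness gives the two cross terms the same real part. -/
theorem numericalValue_smul_add_smul [CompleteSpace F] {r : ℕ} {A : Fin r → F →L[ℂ] F}
    (hA : ∀ i, IsSelfAdjoint (A i)) (v : EuclideanSpace ℝ (Fin r)) (s t : ℝ) (x y : F) :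
    inner ℝ v (numericalValue A ((s : ℂ) • x + (t : ℂ) • y)) =
      s ^ 2 * inner ℝ v (numericalValue A x) + t ^ 2 * inner ℝ v (numericalValue A y) +
        2 * s * t * (inner ℂ (operatorCombination A v x) y).re := by
  have hs := (isSelfAdjoint_operatorCombination hA v).isSymmetric
  have h1 : (inner ℂ (operatorCombination A v y) x).re =
      (inner ℂ (operatorCombination A v x) y).re := by
    have := hs y x
    simp only [ContinuousLinearMap.coe_coe] at this
    rw [this, ← inner_conj_symm, Complex.conj_re]
  simp only [← reApplyInnerSelf_operatorCombination,
    ContinuousLinearMap.reApplyInnerSelf_apply, map_add, map_smul, inner_add_left,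
    inner_add_right, inner_smul_left, inner_smul_right, Complex.conj_ofReal, RCLike.re_eq_complex_re,
    Complex.add_re, Complex.re_ofReal_mul, h1]
  ring

theorem exists_norm_eq_one_re_mul_eq_zero (a : ℂ) : ∃ c : ℂ, ‖c‖ = 1 ∧ (c * a).re = 0 := by
  refine ⟨Complex.I * Complex.exp (((-a.arg : ℝ) : ℂ) * Complex.I), ?_, ?_⟩
  · rw [norm_mul, Complex.norm_exp_ofReal_mul_I]; simp
  · have h : Complex.I * Complex.exp (((-a.arg : ℝ) : ℂ) * Complex.I) * a = Complex.I * ‖a‖ := by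
      calc _ = Complex.I * Complex.exp (((-a.arg : ℝ) : ℂ) * Complex.I) *
            (‖a‖ * Complex.exp (a.arg * Complex.I)) := by rw [Complex.norm_mul_exp_arg_mul_I]
        _ = Complex.I * ‖a‖ * (Complex.exp (((-a.arg : ℝ) : ℂ) * Complex.I) *
            Complex.exp (a.arg * Complex.I)) := by ring
        _ = Complex.I * ‖a‖ := by rw [← Complex.exp_add]; simp
    rw [h]; simp

/-- **Toeplitz–Hausdorff theorem**: the joint numerical range of two self-adjoint operators is
convex. -/
theorem convex_operatorNumericalRange [CompleteSpace F] {A : Fin 2 → F →L[ℂ] F}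
    (hA : ∀ i, IsSelfAdjoint (A i)) : Convex ℝ (operatorNumericalRange A) := by
  rw [convex_iff_segment_subset]
  rintro p ⟨x, hx, hxp⟩ q ⟨y, hy, hyq⟩
  rcases eq_or_ne p q with rfl | hpq
  · rw [segment_same, Set.singleton_subset_iff]
    exact ⟨x, hx, hxp⟩
  rw [mem_sphere_zero_iff_norm] at hx hy
  set e := q - p with he
  have he0 : e ≠ 0 := sub_ne_zero.2 hpq.symm
  set n := quarterTurn e
  have hnq : inner ℝ n q = inner ℝ n p := by
    have := inner_quarterTurn_self e
    rw [he, inner_sub_right] at this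
    linarith
  -- Changing the phase of `x` keeps its value `p`; this phase kills the cross term of the form of
  -- `n` shifted by `⟪n, p⟫`, so the path from `c • x` to `y` has its values on the line through `p`
  -- and `q`.
  obtain ⟨c, hc, hcre⟩ := exists_norm_eq_one_re_mul_eq_zero
    (inner ℂ y (operatorCombination A n x - ((inner ℝ n p : ℝ) : ℂ) • x))
  set x' := c • x with hx'
  have hx'1 : ‖x'‖ = 1 := by simp [hx', norm_smul, hc, hx]
  have hx'p : numericalValue A x' = p := by simp [hx', numericalValue_smul, hc, hxp]
  have hcross : (inner ℂ (operatorCombination A n x') y).re =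
      inner ℝ n p * (inner ℂ x' y).re := by
    have h2 : c * inner ℂ y (operatorCombination A n x - ((inner ℝ n p : ℝ) : ℂ) • x) =
        inner ℂ y (operatorCombination A n x') - (inner ℝ n p : ℝ) * inner ℂ y x' := by
      simp only [hx', map_smul, inner_sub_right, inner_smul_right]; ring
    rw [h2, Complex.sub_re, Complex.re_ofReal_mul] at hcre
    rw [← inner_conj_symm, Complex.conj_re, ← inner_conj_symm x' y, Complex.conj_re]
    linarith
  set z : ℝ → F := fun s => ((1 - s : ℝ) : ℂ) • x' + ((s : ℝ) : ℂ) • y with hz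
  have hznorm : ∀ s, ‖z s‖ ^ 2 = (1 - s) ^ 2 + s ^ 2 + 2 * (1 - s) * s * (inner ℂ x' y).re := by
    intro s
    have h := @norm_add_sq ℂ F _ _ _ (((1 - s : ℝ) : ℂ) • x') (((s : ℝ) : ℂ) • y)
    rw [hz]
    simp only [h, norm_smul, hx'1, hy, inner_smul_left, inner_smul_right, Complex.conj_ofReal,
      RCLike.re_eq_complex_re, Complex.re_ofReal_mul, Complex.norm_real, mul_one,
      Real.norm_eq_abs, sq_abs]
    ring
  -- A zero of the path would make `x'` and `y` proportional and force `p = q`.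
  have hz0 : ∀ s, z s ≠ 0 := by
    intro s hs
    have h1 : ((1 - s : ℝ) : ℂ) • x' = -(((s : ℝ) : ℂ) • y) := eq_neg_of_add_eq_zero_left hs
    have h2 : |1 - s| = |s| := by
      have := congrArg norm h1
      simpa [norm_smul, hx'1, hy, -Complex.ofReal_sub, Complex.norm_real] using this
    have h3 := congrArg (numericalValue A) h1
    rw [← neg_smul, numericalValue_smul A _ y, numericalValue_smul A _ x', hx'p, hyq] at h3
    simp only [norm_neg, Complex.norm_real, Real.norm_eq_abs, h2] at h3
    have hs0 : s ≠ 0 := by rintro rfl; simp at h2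
    exact hpq (smul_right_injective _ (pow_ne_zero 2 (abs_ne_zero.2 hs0)) h3)
  have hzn : ∀ s, inner ℝ n (numericalValue A (z s)) = ‖z s‖ ^ 2 * inner ℝ n p := by
    intro s
    rw [hz]
    simp only
    rw [numericalValue_smul_add_smul hA, hx'p, hyq, hnq, hcross]
    change _ = ‖z s‖ ^ 2 * _
    rw [hznorm]
    ring
  set w : ℝ → EuclideanSpace ℝ (Fin 2) := fun s => (‖z s‖ ^ 2)⁻¹ • numericalValue A (z s) with hw
  have hzc : Continuous z := by rw [hz]; fun_prop
  have hwc : Continuous fun s => inner ℝ e (w s - p) := by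
    refine Continuous.inner continuous_const (Continuous.sub ?_ continuous_const)
    refine Continuous.smul (Continuous.inv₀ (hzc.norm.pow 2) ?_)
      ((continuous_numericalValue A).comp hzc)
    intro s
    simpa using hz0 s
  rw [segment_eq_image']
  rintro _ ⟨t, ht, rfl⟩
  have hw0 : w 0 = p := by simp [hw, hz, hx'1, hx'p]
  have hw1 : w 1 = q := by simp [hw, hz, hy, hyq]
  -- The normalized values stay on the line, so only the coordinate along `e` has to be hit.
  have hivt := intermediate_value_Icc (zero_le_one' ℝ) hwc.continuousOn
  have hmem : t * inner ℝ e e ∈ Set.Icc (inner ℝ e (w 0 - p)) (inner ℝ e (w 1 - p)) := by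
    have hpos : 0 ≤ inner ℝ e e := real_inner_self_nonneg
    rw [hw0, hw1, ← he, sub_self, inner_zero_right]
    exact ⟨mul_nonneg ht.1 hpos, mul_le_of_le_one_left hpos ht.2⟩
  obtain ⟨s, -, hs⟩ := hivt hmem
  have : w s = p + t • e := by
    rw [← sub_eq_zero]
    refine eq_zero_of_inner_quarterTurn he0 ?_ ?_
    · rw [← sub_sub, inner_sub_right, inner_smul_right]
      simp only at hs
      rw [hs, sub_self]
    · have h1 : inner ℝ n (w s) = inner ℝ n p := by
        have : ‖z s‖ ^ 2 ≠ 0 := by simpa using hz0 s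
        simp only [hw, inner_smul_right, hzn]
        rw [inv_mul_cancel_left₀ this]
      change inner ℝ n _ = 0
      rw [inner_sub_right, inner_add_right, h1, inner_smul_right, inner_quarterTurn_self]
      ring
  simp only
  rw [← this]
  exact inv_smul_numericalValue_mem A (hz0 s)

end NumericalRange

/-! ### Corners come from common eigenvectors -/

section NumericalRangeCorner

variable {F : Type*} [NormedAddCommGroup F] [InnerProductSpace ℂ F]

/-- A unit vector whose value maximizes a linear functional on the numerical range is an
eigenvector of the corresponding combination of the operators. -/
theorem operatorCombination_apply_of_isMax [CompleteSpace F] {r : ℕ} {A : Fin r → F →L[ℂ] F}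
    (hA : ∀ i, IsSelfAdjoint (A i)) {n : EuclideanSpace ℝ (Fin r)} {x : F} (hx : ‖x‖ = 1)
    (hmax : ∀ y ∈ operatorNumericalRange A, inner ℝ n y ≤ inner ℝ n (numericalValue A x)) :
    operatorCombination A n x = ((inner ℝ n (numericalValue A x) : ℝ) : ℂ) • x := by
  -- `x` maximizes a quadratic form on the unit sphere; the Lagrange multiplier is the Rayleigh
  -- quotient.
  have h := (isSelfAdjoint_operatorCombination hA n).eq_smul_self_of_isLocalExtrOn (x₀ := x) ?_
  · rw [h, ContinuousLinearMap.rayleighQuotient, reApplyInnerSelf_operatorCombination, hx]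
    simp
  · refine Or.inr (Filter.eventually_of_mem self_mem_nhdsWithin fun z hz => ?_)
    rw [hx] at hz
    simp only [reApplyInnerSelf_operatorCombination]
    exact hmax _ ⟨z, hz, rfl⟩

/-- The common eigenspace of the operators `A i` for the eigenvalues `c i`. -/
def commonEigenspace {r : ℕ} (A : Fin r → F →L[ℂ] F) (c : EuclideanSpace ℝ (Fin r)) :
    Submodule ℂ F where
  carrier := {x | ∀ i, A i x = ((c i : ℝ) : ℂ) • x}
  add_mem' := by
    intro a b ha hb i
    rw [map_add, ha i, hb i, smul_add]
  zero_mem' := by simp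
  smul_mem' := by
    intro t x hx i
    rw [map_smul, hx i, smul_comm]

theorem mem_commonEigenspace {r : ℕ} {A : Fin r → F →L[ℂ] F} {c : EuclideanSpace ℝ (Fin r)}
    {x : F} : x ∈ commonEigenspace A c ↔ ∀ i, A i x = ((c i : ℝ) : ℂ) • x := Iff.rfl

/-- Cramer's rule recovers the equations for `A 0` and `A 1` from the two combinations. -/
theorem mem_commonEigenspace_of_operatorCombination {A : Fin 2 → F →L[ℂ] F}
    {c n₁ n₂ : EuclideanSpace ℝ (Fin 2)} (hn : n₁ 0 * n₂ 1 - n₁ 1 * n₂ 0 ≠ 0) {x : F}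
    (h₁ : operatorCombination A n₁ x = ((inner ℝ n₁ c : ℝ) : ℂ) • x)
    (h₂ : operatorCombination A n₂ x = ((inner ℝ n₂ c : ℝ) : ℂ) • x) :
    x ∈ commonEigenspace A c := by
  have hn' : ((n₁ 0 * n₂ 1 - n₁ 1 * n₂ 0 : ℝ) : ℂ) ≠ 0 := by exact_mod_cast hn
  simp only [operatorCombination, Fin.sum_univ_two, add_apply, smul_apply, inner_plane] at h₁ h₂
  push_cast at h₁ h₂ hn'
  have k0 : ((n₁ 0 * n₂ 1 - n₁ 1 * n₂ 0 : ℂ)) • (A 0 x - ((c 0 : ℝ) : ℂ) • x) = 0 := by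
    linear_combination (norm := module) (n₂ 1 : ℂ) • h₁ - (n₁ 1 : ℂ) • h₂
  have k1 : ((n₁ 0 * n₂ 1 - n₁ 1 * n₂ 0 : ℂ)) • (A 1 x - ((c 1 : ℝ) : ℂ) • x) = 0 := by
    linear_combination (norm := module) (n₁ 0 : ℂ) • h₂ - (n₂ 0 : ℂ) • h₁
  rw [mem_commonEigenspace]
  intro i
  fin_cases i
  · exact sub_eq_zero.1 ((smul_eq_zero.1 k0).resolve_left hn')
  · exact sub_eq_zero.1 ((smul_eq_zero.1 k1).resolve_left hn')

/-- The cross terms vanish because `A i` maps `k` to a multiple of itself, which is orthogonal to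
`b`. -/
theorem numericalValue_add_of_mem_commonEigenspace [CompleteSpace F] {r : ℕ}
    {A : Fin r → F →L[ℂ] F} (hA : ∀ i, IsSelfAdjoint (A i)) {c : EuclideanSpace ℝ (Fin r)}
    {k b : F} (hk : k ∈ commonEigenspace A c) (hb : b ∈ (commonEigenspace A c)ᗮ) :
    numericalValue A (k + b) = ‖k‖ ^ 2 • c + numericalValue A b := by
  have hkb : inner ℂ k b = 0 := hb k hk
  have hbk : inner ℂ b k = 0 := inner_eq_zero_symm.1 hkb
  ext i
  have hs : inner ℂ (A i b) k = inner ℂ b (A i k) := (hA i).isSymmetric b k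
  have hki := hk i
  simp only [numericalValue_apply, ContinuousLinearMap.reApplyInnerSelf_apply, map_add,
    inner_add_left, inner_add_right, hs, hki, inner_smul_left, inner_smul_right, hkb, hbk,
    PiLp.add_apply, PiLp.smul_apply, inner_self_eq_norm_sq_to_K, Complex.conj_ofReal,
    RCLike.re_eq_complex_re]
  simp [← Complex.ofReal_pow, mul_comm]

/-- At a point `c` with two independent support functionals, the numerical range is a cone with
apex `c` over a compact set that does not contain `c`. -/
theorem exists_isCompact_cone_of_corner [FiniteDimensional ℂ F] {A : Fin 2 → F →L[ℂ] F}
    (hA : ∀ i, IsSelfAdjoint (A i)) {c n₁ n₂ : EuclideanSpace ℝ (Fin 2)}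
    (hn : n₁ 0 * n₂ 1 - n₁ 1 * n₂ 0 ≠ 0)
    (h₁ : ∀ y ∈ operatorNumericalRange A, inner ℝ n₁ y ≤ inner ℝ n₁ c)
    (h₂ : ∀ y ∈ operatorNumericalRange A, inner ℝ n₂ y ≤ inner ℝ n₂ c) :
    ∃ V ⊆ operatorNumericalRange A, IsCompact V ∧ c ∉ V ∧
      ∀ y ∈ operatorNumericalRange A, y = c ∨ ∃ v ∈ V, ∃ t : ℝ, 0 ≤ t ∧ y - c = t • (v - c) := by
  have : ProperSpace F := FiniteDimensional.proper ℂ F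
  set K := commonEigenspace A c
  refine ⟨numericalValue A '' (Metric.sphere 0 1 ∩ (Kᗮ : Set F)),
    Set.image_mono Set.inter_subset_left, ?_, ?_, ?_⟩
  · exact ((isCompact_sphere 0 1).inter_right (Submodule.isClosed_orthogonal K)).image
      (continuous_numericalValue A)
  · rintro ⟨x, ⟨hx, hxK⟩, rfl⟩
    rw [mem_sphere_zero_iff_norm] at hx
    have hmem : x ∈ K := mem_commonEigenspace_of_operatorCombination hn
      (operatorCombination_apply_of_isMax hA hx h₁) (operatorCombination_apply_of_isMax hA hx h₂)
    have h0 : inner ℂ x x = 0 := hxK x hmem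
    rw [inner_self_eq_zero] at h0
    simp [h0] at hx
  · rintro y ⟨x, hx, rfl⟩
    rw [mem_sphere_zero_iff_norm] at hx
    obtain ⟨k, hk, b, hb, rfl⟩ := K.exists_add_mem_mem_orthogonal x
    have hval := numericalValue_add_of_mem_commonEigenspace hA hk hb
    have hnorm : ‖k‖ ^ 2 + ‖b‖ ^ 2 = 1 := by
      have := norm_add_sq_eq_norm_sq_add_norm_sq_of_inner_eq_zero k b (hb k hk)
      rw [hx] at this
      nlinarith
    rcases eq_or_ne b 0 with rfl | hb0
    · left
      rw [hval]
      rw [show ‖k‖ ^ 2 = 1 by simpa using hnorm]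
      ext i
      simp [numericalValue_apply, ContinuousLinearMap.reApplyInnerSelf_apply]
    · right
      -- Since `‖k‖ ^ 2 = 1 - ‖b‖ ^ 2`, the value is a convex combination of `c` and the value of `b
      -- / ‖b‖`, with weight `‖b‖ ^ 2` on the latter.
      refine ⟨_, ⟨((‖b‖⁻¹ : ℝ) : ℂ) • b, ⟨?_, Kᗮ.smul_mem _ hb⟩, rfl⟩, ‖b‖ ^ 2, by positivity, ?_⟩
      · simp [norm_smul, hb0]
      · rw [numericalValue_smul, hval, eq_sub_of_add_eq hnorm]
        have : ‖b‖ ≠ 0 := norm_ne_zero_iff.2 hb0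
        simp only [Complex.norm_real, norm_inv, norm_norm, smul_sub, smul_smul, inv_pow]
        rw [mul_inv_cancel₀ (pow_ne_zero 2 this)]
        module

end NumericalRangeCorner

/-! ### From matrices to operators -/

section Matrix

theorem jointNumericalRange_eq_operatorNumericalRange {d r : ℕ}
    {u : Fin r → Matrix (Fin d) (Fin d) ℂ} (hu : ∀ i, (u i).IsHermitian) :
    jointNumericalRange u =
      operatorNumericalRange fun i => Matrix.toEuclideanCLM (𝕜 := ℂ) (u i) := by
  have hinner : ∀ (i : Fin r) (x : EuclideanSpace ℂ (Fin d)),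
      inner ℂ x (Matrix.toEuclideanCLM (𝕜 := ℂ) (u i) x) = star x.ofLp ⬝ᵥ (u i *ᵥ x.ofLp) := by
    intro i x
    rw [EuclideanSpace.inner_eq_star_dotProduct, dotProduct_comm, Matrix.ofLp_toEuclideanCLM]
  have hreal : ∀ (i : Fin r) (x : EuclideanSpace ℂ (Fin d)),
      (((Matrix.toEuclideanCLM (𝕜 := ℂ) (u i)).reApplyInnerSelf x : ℝ) : ℂ) =
        star x.ofLp ⬝ᵥ (u i *ᵥ x.ofLp) := by
    intro i x
    have hs : IsSelfAdjoint (Matrix.toEuclideanCLM (𝕜 := ℂ) (u i)) :=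
      IsSelfAdjoint.map (hu i) (Matrix.toEuclideanCLM (𝕜 := ℂ))
    rw [← hinner]
    exact (hs.isSymmetric.coe_reApplyInnerSelf_apply x).trans (hs.isSymmetric x x)
  have hnorm : ∀ x : EuclideanSpace ℂ (Fin d), star x.ofLp ⬝ᵥ x.ofLp = 1 ↔ ‖x‖ = 1 := by
    intro x
    rw [dotProduct_comm, ← EuclideanSpace.inner_eq_star_dotProduct, inner_self_eq_norm_sq_to_K]
    have h : ((‖x‖ : ℂ) ^ 2 = 1) ↔ ‖x‖ ^ 2 = 1 := by norm_cast
    exact h.trans <| pow_eq_one_iff_of_nonneg (norm_nonneg x) two_ne_zero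
  ext w
  constructor
  · rintro ⟨x, hx, hw⟩
    refine ⟨WithLp.toLp 2 x, ?_, ?_⟩
    · rw [mem_sphere_zero_iff_norm, ← hnorm]
      exact hx
    · ext i
      have := hreal i (WithLp.toLp 2 x)
      rw [numericalValue_apply]
      rw [← hw i] at this
      exact_mod_cast this
  · rintro ⟨x, hx, rfl⟩
    rw [mem_sphere_zero_iff_norm, ← hnorm] at hx
    exact ⟨x.ofLp, hx, fun i => by rw [numericalValue_apply, hreal]⟩

end Matrix

/-! ### Convex sets in the plane and simplicial points -/

section PlanarConvex

/-- The functionals `α`, `β` are the coordinates with respect to the basis `u`, `v`. -/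
structure IsCoordinates (u v : EuclideanSpace ℝ (Fin 2))
    (α β : EuclideanSpace ℝ (Fin 2) →L[ℝ] ℝ) : Prop where
  eq_add : ∀ z, z = α z • u + β z • v
  fst_left : α u = 1
  fst_right : α v = 0
  snd_left : β u = 0
  snd_right : β v = 1

theorem IsCoordinates.swap {u v : EuclideanSpace ℝ (Fin 2)}
    {α β : EuclideanSpace ℝ (Fin 2) →L[ℝ] ℝ} (h : IsCoordinates u v α β) :
    IsCoordinates v u β α :=
  ⟨fun z => by rw [add_comm]; exact h.eq_add z, h.snd_right, h.snd_left, h.fst_right, h.fst_left⟩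

theorem exists_isCoordinates {u v : EuclideanSpace ℝ (Fin 2)}
    (h : u 0 * v 1 - u 1 * v 0 ≠ 0) : ∃ α β, IsCoordinates u v α β := by
  set D := u 0 * v 1 - u 1 * v 0
  refine ⟨D⁻¹ • innerSL ℝ (!₂[v 1, -(v 0)]), D⁻¹ • innerSL ℝ (!₂[-(u 1), u 0]), ?_, ?_, ?_, ?_, ?_⟩
  · intro z
    ext i
    fin_cases i
    · simp [inner_plane]
      field_simp
      ring
    · simp [inner_plane]
      field_simp
      ring
  · simp [inner_plane]
    field_simp
    ring
  · simp [inner_plane, mul_comm]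
  · simp [inner_plane, mul_comm]
  · simp [inner_plane]
    field_simp
    ring

theorem exists_inner_ne_of_affineDim_eq_two {C : Set (EuclideanSpace ℝ (Fin 2))}
    (hC : affineDim C = 2) {n : EuclideanSpace ℝ (Fin 2)} (hn : n ≠ 0) (c : ℝ) :
    ∃ y ∈ C, inner ℝ n y ≠ c := by
  by_contra! h
  have htop : vectorSpan ℝ C = ⊤ := by
    apply Submodule.eq_top_of_finrank_eq
    rw [finrank_euclideanSpace_fin]
    exact hC
  have hle : vectorSpan ℝ C ≤ (ℝ ∙ n)ᗮ := by
    rw [vectorSpan_def, Submodule.span_le]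
    rintro _ ⟨a, ha, b, hb, rfl⟩
    simp only [SetLike.mem_coe, Submodule.mem_orthogonal_singleton_iff_inner_right, vsub_eq_sub,
      inner_sub_right, h a ha, h b hb, sub_self]
  rw [htop, top_le_iff] at hle
  have hmem : n ∈ (ℝ ∙ n)ᗮ := hle ▸ Submodule.mem_top
  rw [Submodule.mem_orthogonal_singleton_iff_inner_right, inner_self_eq_zero] at hmem
  exact hn hmem

/-- A convex set has a support functional at each of its points outside the interior. -/
theorem Convex.exists_inner_le_of_notMem_interior {C : Set (EuclideanSpace ℝ (Fin 2))}
    (hC : Convex ℝ C) {x : EuclideanSpace ℝ (Fin 2)} (hx : x ∈ C) (hxi : x ∉ interior C) :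
    ∃ n : EuclideanSpace ℝ (Fin 2), n ≠ 0 ∧ ∀ y ∈ C, inner ℝ n y ≤ inner ℝ n x := by
  by_cases hi : (interior C).Nonempty
  · obtain ⟨f, hf, hmax⟩ := geometric_hahn_banach_of_nonempty_interior_point hC hxi hi
    refine ⟨(InnerProductSpace.toDual ℝ _).symm f, by simpa using hf, fun y hy => ?_⟩
    simpa using hmax y hy
  · rw [hC.interior_nonempty_iff_affineSpan_eq_top] at hi
    have hne : vectorSpan ℝ C ≠ ⊤ := by
      rwa [ne_eq, ← AffineSubspace.affineSpan_eq_top_iff_vectorSpan_eq_top_of_nonempty ℝ _ _ ⟨x, hx⟩]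
    -- With empty interior the set lies in a line; a normal to its direction is constant on it.
    have hperp : (vectorSpan ℝ C)ᗮ ≠ ⊥ := by
      rwa [ne_eq, Submodule.orthogonal_eq_bot_iff]
    obtain ⟨n, hn, hn0⟩ := Submodule.exists_mem_ne_zero_of_ne_bot hperp
    refine ⟨n, hn0, fun y hy => ?_⟩
    have := Submodule.inner_left_of_mem_orthogonal (vsub_mem_vectorSpan ℝ hy hx) hn
    rw [vsub_eq_sub, inner_sub_right] at this
    linarith

theorem notMem_interior_of_inner_le {C : Set (EuclideanSpace ℝ (Fin 2))}
    {n x : EuclideanSpace ℝ (Fin 2)} (hn : n ≠ 0) (h : ∀ y ∈ C, inner ℝ n y ≤ inner ℝ n x) :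
    x ∉ interior C := by
  intro hx
  have hc : ContinuousAt (fun t : ℝ => x + t • n) 0 := by fun_prop
  have hev : ∀ᶠ t in 𝓝 (0 : ℝ), x + t • n ∈ C :=
    hc.eventually_mem (by simpa using mem_interior_iff_mem_nhds.1 hx)
  obtain ⟨t, ht, ht0⟩ := ((hev.filter_mono nhdsWithin_le_nhds).and
    (self_mem_nhdsWithin (s := Set.Ioi (0 : ℝ)))).exists
  have := h _ ht
  rw [inner_add_right, inner_smul_right] at this
  have hp := mul_pos ht0 (real_inner_self_pos.2 hn)
  linarith

/-- The relative interior of a non-trivial segment is the open segment. -/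
theorem intrinsicInterior_segment {a b : EuclideanSpace ℝ (Fin 2)} (hab : a ≠ b) :
    intrinsicInterior ℝ (segment ℝ a b) = openSegment ℝ a b := by
  have hline : ∀ t : ℝ, AffineMap.lineMap a b t ∈ affineSpan ℝ (segment ℝ a b) := fun t =>
    AffineMap.lineMap_mem t (subset_affineSpan ℝ _ (left_mem_segment ℝ a b))
      (subset_affineSpan ℝ _ (right_mem_segment ℝ a b))
  have hinj : Function.Injective (AffineMap.lineMap a b : ℝ →ᵃ[ℝ] EuclideanSpace ℝ (Fin 2)) :=
    AffineMap.lineMap_injective ℝ hab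
  apply Set.Subset.antisymm
  · intro x hx
    obtain ⟨y, hy, rfl⟩ := mem_intrinsicInterior.1 hx
    have hmem : (y : EuclideanSpace ℝ (Fin 2)) ∈ segment ℝ a b :=
      interior_subset (s := Subtype.val ⁻¹' segment ℝ a b) hy
    obtain ⟨t, -, ht⟩ := (segment_eq_image_lineMap ℝ a b).subset hmem
    set φ : ℝ → affineSpan ℝ (segment ℝ a b) := fun s => ⟨AffineMap.lineMap a b s, hline s⟩
    have hφ : Continuous φ := by
      refine Continuous.subtype_mk ?_ _
      exact AffineMap.lineMap_continuous
    have hopen := isOpen_interior.preimage hφ (t := interior ((↑) ⁻¹' segment ℝ a b))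
    -- Pulled back to the parameter line, the relative interior is an open subset of `[0, 1]`, so it
    -- avoids the endpoints.
    have hsub : φ ⁻¹' interior ((↑) ⁻¹' segment ℝ a b) ⊆ Set.Icc 0 1 := by
      intro s hs
      have h1 : AffineMap.lineMap a b s ∈ segment ℝ a b := 
        interior_subset (s := Subtype.val ⁻¹' segment ℝ a b) hs
      rw [segment_eq_image_lineMap] at h1
      obtain ⟨s', hs', he⟩ := h1
      rwa [← hinj he]
    have ht' : t ∈ φ ⁻¹' interior ((↑) ⁻¹' segment ℝ a b) := by
      have : φ t = y := Subtype.ext ht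
      rw [Set.mem_preimage, this]
      exact hy
    have := interior_maximal hsub hopen ht'
    rw [interior_Icc] at this
    rw [openSegment_eq_image_lineMap]
    exact ⟨t, this, ht⟩
  · intro x hx
    rw [openSegment_eq_image_lineMap] at hx
    obtain ⟨t, ht, rfl⟩ := hx
    refine mem_intrinsicInterior.2 ⟨⟨_, hline t⟩, ?_, rfl⟩
    -- A continuous inverse of the parametrization, so parameters in `(0, 1)` form an open set of
    -- the affine span.
    set τ : affineSpan ℝ (segment ℝ a b) → ℝ :=
      fun y => inner ℝ (b - a) ((y : EuclideanSpace ℝ (Fin 2)) - a) / inner ℝ (b - a) (b - a)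
    have hτ : Continuous τ := by fun_prop
    have hpos : inner ℝ (b - a) (b - a) ≠ 0 := by
      rw [ne_eq, inner_self_eq_zero, sub_eq_zero]
      exact hab.symm
    have hτline : ∀ s, τ ⟨_, hline s⟩ = s := by
      intro s
      simp only [τ, AffineMap.lineMap_apply, vsub_eq_sub, vadd_eq_add, add_sub_cancel_right,
        inner_smul_right]
      field_simp
    have hopen : IsOpen (τ ⁻¹' Set.Ioo 0 1) := isOpen_Ioo.preimage hτ
    refine interior_maximal ?_ hopen ?_
    · rintro ⟨y, hy⟩ hy'
      have hy2 : y ∈ line[ℝ, a, b] := by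
        have : affineSpan ℝ (segment ℝ a b) = line[ℝ, a, b] := by
          rw [← convexHull_pair, affineSpan_convexHull]
        rwa [← this]
      obtain ⟨s, rfl⟩ := mem_affineSpan_pair_iff_exists_lineMap_eq.1 hy2
      rw [Set.mem_preimage, hτline] at hy'
      exact (segment_eq_image_lineMap ℝ a b).superset
        ⟨s, Set.Ioo_subset_Icc_self hy', rfl⟩
    · rw [Set.mem_preimage, hτline]
      exact ht

/-- A point near which a convex set agrees with a triangle spanned by three of its points is
simplicial. -/
theorem IsCoordinates.isSimplicialPoint {C : Set (EuclideanSpace ℝ (Fin 2))} (hC : Convex ℝ C)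
    {a b c x : EuclideanSpace ℝ (Fin 2)} (ha : a ∈ C) (hb : b ∈ C) (hc : c ∈ C) (hx : x ∈ C)
    {α β : EuclideanSpace ℝ (Fin 2) →L[ℝ] ℝ} (h : IsCoordinates (b - a) (c - a) α β)
    (hev : ∀ᶠ y in 𝓝[C] x, 0 ≤ α (y - a) ∧ 0 ≤ β (y - a) ∧ α (y - a) + β (y - a) ≤ 1) :
    IsSimplicialPoint C x := by
  have hind : AffineIndependent ℝ ![a, b, c] := by
    rw [affineIndependent_iff_not_collinear_set]
    intro hcol
    obtain ⟨v, hv⟩ := (collinear_iff_of_mem (p₀ := a) (by simp)).1 hcol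
    obtain ⟨r, hr⟩ := hv b (by simp)
    obtain ⟨s, hs⟩ := hv c (by simp)
    have hr' : b - a = r • v := by rw [hr]; simp
    have hs' : c - a = s • v := by rw [hs]; simp
    have e1 := h.fst_left
    have e2 := h.fst_right
    have e3 := h.snd_right
    rw [hr', map_smul, smul_eq_mul] at e1
    rw [hs', map_smul, smul_eq_mul] at e2 e3
    rcases mul_eq_zero.1 e2 with h0 | h0
    · simp [h0] at e3
    · simp [h0] at e1
  have hrange : Set.range ![a, b, c] = {a, b, c} := by
    ext y; simp [eq_comm]; tauto
  refine ⟨hx, 1, fun _ => 2, fun _ => ⟨![a, b, c], hind⟩, fun _ => ?_, ?_⟩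
  · refine convexHull_min ?_ hC
    rw [hrange]
    rintro y (rfl | rfl | rfl) <;> assumption
  · filter_upwards [hev] with y ⟨h1, h2, h3⟩
    refine Set.mem_iUnion.2 ⟨0, ?_⟩
    simp only [hrange]
    -- The barycentric coordinates of `y` in the triangle `a b c`.
    have hy : y = (1 - α (y - a) - β (y - a)) • a + α (y - a) • b + β (y - a) • c := by
      have := h.eq_add (y - a)
      rw [sub_eq_iff_eq_add] at this
      refine this.trans ?_
      module
    have hconv := convex_convexHull ℝ ({a, b, c} : Set (EuclideanSpace ℝ (Fin 2)))
    have hs : ∀ z ∈ ({a, b, c} : Set (EuclideanSpace ℝ (Fin 2))),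
      z ∈ convexHull ℝ {a, b, c} := fun z hz => subset_convexHull ℝ _ hz
    rw [hy]
    have := hconv.sum_mem (t := Finset.univ)
      (w := ![1 - α (y - a) - β (y - a), α (y - a), β (y - a)]) (z := ![a, b, c]) ?_ ?_ ?_
    · simpa [Fin.sum_univ_three, add_assoc] using this
    · intro i _
      fin_cases i
      · change 0 ≤ 1 - α (y - a) - β (y - a)
        linarith
      · exact h1
      · exact h2
    · rw [Fin.sum_univ_three]
      change 1 - α (y - a) - β (y - a) + α (y - a) + β (y - a) = 1
      ring
    · intro i _
      fin_cases i <;> exact hs _ (by simp)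

/-- For small `t > 0` the triangle with vertices `x - t • (u + v)`, `x + t • u`, `x + t • v` lies in
the set, and `x` is its centroid. -/
theorem isSimplicialPoint_of_mem_interior {C : Set (EuclideanSpace ℝ (Fin 2))} (hC : Convex ℝ C)
    {x : EuclideanSpace ℝ (Fin 2)} (hx : x ∈ interior C) : IsSimplicialPoint C x := by
  obtain ⟨u, hu⟩ : ∃ u : EuclideanSpace ℝ (Fin 2), u = !₂[1, 0] := ⟨_, rfl⟩
  obtain ⟨v, hv⟩ : ∃ v : EuclideanSpace ℝ (Fin 2), v = !₂[0, 1] := ⟨_, rfl⟩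
  have hev : ∀ w : EuclideanSpace ℝ (Fin 2), ∀ᶠ t in 𝓝[>] (0 : ℝ), x + t • w ∈ C := by
    intro w
    have hc : ContinuousAt (fun t : ℝ => x + t • w) 0 := by fun_prop
    exact (hc.eventually_mem (by simpa using mem_interior_iff_mem_nhds.1 hx)).filter_mono
      nhdsWithin_le_nhds
  obtain ⟨t, ⟨⟨ha, hb⟩, hc⟩, ht⟩ := ((((hev (-(u + v))).and (hev u)).and (hev v)).and
    (self_mem_nhdsWithin (s := Set.Ioi (0 : ℝ)))).exists
  have ht0 : t ≠ 0 := ne_of_gt ht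
  obtain ⟨α, β, h⟩ := exists_isCoordinates (u := x + t • u - (x + t • -(u + v)))
    (v := x + t • v - (x + t • -(u + v))) (by
      simp [hu, hv]
      ring_nf
      simp [ht0])
  have hxa : x - (x + t • -(u + v)) = (1 / 3 : ℝ) • (x + t • u - (x + t • -(u + v))) +
      (1 / 3 : ℝ) • (x + t • v - (x + t • -(u + v))) := by module
  have hα : α (x - (x + t • -(u + v))) = 1 / 3 := by
    rw [hxa, map_add, map_smul, map_smul, h.fst_left, h.fst_right]; simp
  have hβ : β (x - (x + t • -(u + v))) = 1 / 3 := by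
    rw [hxa, map_add, map_smul, map_smul, h.snd_left, h.snd_right]; simp
  refine h.isSimplicialPoint hC ha hb hc (interior_subset hx)
    (Filter.Eventually.filter_mono nhdsWithin_le_nhds ?_)
  have c1 : ContinuousAt (fun y => α (y - (x + t • -(u + v)))) x := by fun_prop
  have c2 : ContinuousAt (fun y => β (y - (x + t • -(u + v)))) x := by fun_prop
  have c3 : ContinuousAt
    (fun y => α (y - (x + t • -(u + v))) + β (y - (x + t • -(u + v)))) x := by fun_prop
  filter_upwards [c1.eventually_const_lt (u := 0) (by simp only [hα]; norm_num),
    c2.eventually_const_lt (u := 0) (by simp only [hβ]; norm_num),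
    c3.eventually_lt_const (u := 1) (by simp only [hα, hβ]; norm_num)] with y h1 h2 h3
  exact ⟨h1.le, h2.le, h3.le⟩

/-- Every point of a compact convex set of dimension at most one is simplicial. -/
theorem isSimplicialPoint_of_affineDim_le_one {C : Set (EuclideanSpace ℝ (Fin 2))}
    (hC : Convex ℝ C) (hcomp : IsCompact C) (hdim : affineDim C ≤ 1)
    {x : EuclideanSpace ℝ (Fin 2)} (hx : x ∈ C) : IsSimplicialPoint C x := by
  obtain ⟨v, hv⟩ := (collinear_iff_of_mem hx).1 (collinear_iff_finrank_le_one.2 hdim)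
  have hcont : ContinuousOn (fun y => inner ℝ v y) C := by fun_prop
  obtain ⟨a, ha, hmin⟩ := hcomp.exists_isMinOn ⟨x, hx⟩ hcont
  obtain ⟨b, hb, hmax⟩ := hcomp.exists_isMaxOn ⟨x, hx⟩ hcont
  have hseg : C ⊆ segment ℝ a b := by
    intro y hy
    have h1 : inner ℝ v a ≤ inner ℝ v y := hmin hy
    have h2 : inner ℝ v y ≤ inner ℝ v b := hmax hy
    obtain ⟨ra, hra⟩ := hv a ha
    obtain ⟨rb, hrb⟩ := hv b hb
    obtain ⟨ry, hry⟩ := hv y hy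
    rcases eq_or_ne v 0 with rfl | hv0
    · simp at hra hrb hry
      rw [hra, hrb, hry]
      simp
    · have hp := real_inner_self_pos.2 hv0
      rw [hra, hry] at h1
      rw [hrb, hry] at h2
      simp only [vadd_eq_add, inner_add_right, inner_smul_right, add_le_add_iff_right] at h1 h2
      have h1' := le_of_mul_le_mul_right h1 hp
      have h2' := le_of_mul_le_mul_right h2 hp
      have : ry ∈ segment ℝ ra rb := by
        rw [segment_eq_Icc (h1'.trans h2')]
        exact ⟨h1', h2'⟩
      obtain ⟨s, t, hs, ht, hst, rfl⟩ := this
      refine ⟨s, t, hs, ht, hst, ?_⟩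
      rw [hra, hrb, hry]
      obtain rfl : t = 1 - s := by linarith
      simp only [vadd_eq_add, smul_eq_mul]
      module
  rcases eq_or_ne a b with rfl | hab
  · refine ⟨hx, 1, fun _ => 0, fun _ => Affine.Simplex.mkOfPoint ℝ a, fun _ => ?_, ?_⟩
    · refine convexHull_min ?_ hC
      rintro _ ⟨i, rfl⟩
      exact ha
    · filter_upwards [self_mem_nhdsWithin] with y hy
      have := hseg hy
      rw [segment_same, Set.mem_singleton_iff] at this
      refine Set.mem_iUnion.2 ⟨0, subset_convexHull ℝ _ ⟨0, ?_⟩⟩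
      exact this.symm
  · have hrange : Set.range ![a, b] = {a, b} := by
      ext y; simp [eq_comm]; tauto
    refine ⟨hx, 1, fun _ => 1, fun _ => ⟨![a, b], affineIndependent_of_ne ℝ hab⟩,
      fun _ => ?_, ?_⟩
    · refine convexHull_min ?_ hC
      rw [hrange]
      rintro y (rfl | rfl) <;> assumption
    · filter_upwards [self_mem_nhdsWithin] with y hy
      refine Set.mem_iUnion.2 ⟨0, ?_⟩
      simp only [hrange, convexHull_pair]
      exact hseg hy

end PlanarConvex

/-! ### The angle at a corner point -/

section Corner

/-- The support functionals of two distinct supporting lines through a point are independent. -/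
theorem IsCornerPoint.exists_support {C : Set (EuclideanSpace ℝ (Fin 2))}
    {x : EuclideanSpace ℝ (Fin 2)} (h : IsCornerPoint C x) :
    ∃ n₁ n₂ : EuclideanSpace ℝ (Fin 2), n₁ 0 * n₂ 1 - n₁ 1 * n₂ 0 ≠ 0 ∧
      (∀ y ∈ C, inner ℝ n₁ y ≤ inner ℝ n₁ x) ∧ ∀ y ∈ C, inner ℝ n₂ y ≤ inner ℝ n₂ x := by
  obtain ⟨-, l₁, l₂, ⟨n₁, c₁, hn₁, rfl, -, h₁⟩, ⟨n₂, c₂, hn₂, rfl, -, h₂⟩, hx₁, hx₂, hne⟩ := h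
  simp only [Set.mem_ofPred_eq] at hx₁ hx₂
  subst hx₁ hx₂
  refine ⟨n₁, n₂, fun hdet => hne ?_, h₁, h₂⟩
  -- A zero determinant makes the normals parallel, and two parallel lines through `x` coincide.
  obtain ⟨a, ha⟩ := eq_smul_quarterTurn_of_inner_eq_zero (v := n₂) (quarterTurn_ne_zero hn₁)
    (by rw [inner_plane]; simp [quarterTurn]; linarith)
  have ha' : n₂ = (-a) • n₁ := by
    rw [ha, quarterTurn_quarterTurn, smul_neg, neg_smul]
  have ha0 : -a ≠ 0 := by
    intro h0
    rw [h0, zero_smul] at ha'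
    exact hn₂ ha'
  ext y
  simp only [Set.mem_ofPred_eq, ha', inner_smul_left, conj_trivial]
  exact (mul_right_inj' ha0).symm

theorem eq_zero_of_inner_eq_zero_of_det_ne_zero {n₁ n₂ z : EuclideanSpace ℝ (Fin 2)}
    (hn : n₁ 0 * n₂ 1 - n₁ 1 * n₂ 0 ≠ 0) (h₁ : inner ℝ n₁ z = 0) (h₂ : inner ℝ n₂ z = 0) :
    z = 0 := by
  rw [inner_plane] at h₁ h₂
  have e0 : (n₁ 0 * n₂ 1 - n₁ 1 * n₂ 0) * z 0 = 0 := by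
    linear_combination n₂ 1 * h₁ - n₁ 1 * h₂
  have e1 : (n₁ 0 * n₂ 1 - n₁ 1 * n₂ 0) * z 1 = 0 := by
    linear_combination n₁ 0 * h₂ - n₂ 0 * h₁
  ext i
  fin_cases i
  · exact (mul_eq_zero.1 e0).resolve_left hn
  · exact (mul_eq_zero.1 e1).resolve_left hn

/-- A two-dimensional planar set that is a pointed cone over a compact set lies in the quadrant
spanned by two of its points. -/
theorem exists_isCoordinates_of_cone {C V : Set (EuclideanSpace ℝ (Fin 2))}
    (hdim : affineDim C = 2) {c n₁ n₂ : EuclideanSpace ℝ (Fin 2)}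
    (hn : n₁ 0 * n₂ 1 - n₁ 1 * n₂ 0 ≠ 0)
    (h₁ : ∀ y ∈ C, inner ℝ n₁ y ≤ inner ℝ n₁ c) (h₂ : ∀ y ∈ C, inner ℝ n₂ y ≤ inner ℝ n₂ c)
    (hVC : V ⊆ C) (hV : IsCompact V) (hcV : c ∉ V)
    (hcone : ∀ y ∈ C, y = c ∨ ∃ v ∈ V, ∃ t : ℝ, 0 ≤ t ∧ y - c = t • (v - c)) :
    ∃ p ∈ C, ∃ q ∈ C, ∃ α β, IsCoordinates (p - c) (q - c) α β ∧
      ∀ y ∈ C, 0 ≤ α (y - c) ∧ 0 ≤ β (y - c) := by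
  have hn₁ : n₁ ≠ 0 := by rintro rfl; simp at hn
  -- `f` is a height above the apex, positive on `V - c`, and `g / f` is the slope of a ray. Slopes
  -- do not change along rays, so bounds on `V` pass to all of `C`.
  set f : EuclideanSpace ℝ (Fin 2) →L[ℝ] ℝ := -innerSL ℝ (n₁ + n₂) with hf
  set g : EuclideanSpace ℝ (Fin 2) →L[ℝ] ℝ := innerSL ℝ n₁ with hg
  have hfapp : ∀ z, f z = -(inner ℝ n₁ z + inner ℝ n₂ z) := by
    intro z; simp [hf]
  have hgapp : ∀ z, g z = inner ℝ n₁ z := fun z => by simp [hg]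
  have hfpos : ∀ v ∈ V, 0 < f (v - c) := by
    intro v hv
    have k₁ := h₁ v (hVC hv)
    have k₂ := h₂ v (hVC hv)
    rw [hfapp, inner_sub_right, inner_sub_right]
    by_contra! hle
    have hz := eq_zero_of_inner_eq_zero_of_det_ne_zero hn (z := v - c)
      (by rw [inner_sub_right]; linarith) (by rw [inner_sub_right]; linarith)
    rw [sub_eq_zero] at hz
    exact hcV (hz ▸ hv)
  have hVne : V.Nonempty := by
    by_contra hemp
    rw [Set.not_nonempty_iff_eq_empty] at hemp
    obtain ⟨y, hy, hyne⟩ := exists_inner_ne_of_affineDim_eq_two hdim hn₁ (inner ℝ n₁ c)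
    rcases hcone y hy with rfl | ⟨v, hv, -⟩
    · exact hyne rfl
    · simp [hemp] at hv
  have hcont : ContinuousOn (fun v => g (v - c) / f (v - c)) V :=
    ContinuousOn.div (by fun_prop) (by fun_prop) fun v hv => (hfpos v hv).ne'
  obtain ⟨p, hp, hmin⟩ := hV.exists_isMinOn hVne hcont
  obtain ⟨q, hq, hmax⟩ := hV.exists_isMaxOn hVne hcont
  obtain ⟨m, hm⟩ : ∃ m, m = g (p - c) / f (p - c) := ⟨_, rfl⟩
  obtain ⟨M, hM⟩ : ∃ M, M = g (q - c) / f (q - c) := ⟨_, rfl⟩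
  have hgp : g (p - c) = m * f (p - c) := by rw [hm, div_mul_cancel₀ _ (hfpos p hp).ne']
  have hgq : g (q - c) = M * f (q - c) := by rw [hM, div_mul_cancel₀ _ (hfpos q hq).ne']
  have hlow : ∀ y ∈ C, m * f (y - c) ≤ g (y - c) := by
    intro y hy
    rcases hcone y hy with rfl | ⟨v, hv, t, ht, hyv⟩
    · simp
    · have : m ≤ g (v - c) / f (v - c) := hm ▸ hmin hv
      rw [le_div_iff₀ (hfpos v hv)] at this
      rw [hyv, map_smul, map_smul, smul_eq_mul, smul_eq_mul]
      nlinarith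
  have hup : ∀ y ∈ C, g (y - c) ≤ M * f (y - c) := by
    intro y hy
    rcases hcone y hy with rfl | ⟨v, hv, t, ht, hyv⟩
    · simp
    · have : g (v - c) / f (v - c) ≤ M := hM ▸ hmax hv
      rw [div_le_iff₀ (hfpos v hv)] at this
      rw [hyv, map_smul, map_smul, smul_eq_mul, smul_eq_mul]
      nlinarith
  have hmM : m < M := by
    refine lt_of_le_of_ne (by rw [hm, hM]; exact hmin hq) fun heq => ?_
    -- If all slopes equal `m`, then `g - m f` vanishes on `C - c`; this is the vector representing
    -- `g - m f`, so `C` would lie in a line.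
    have hn0 : (1 + m) • n₁ + m • n₂ ≠ 0 := by
      intro h0
      have e0 := congrArg (fun w : EuclideanSpace ℝ (Fin 2) => w 0) h0
      have e1 := congrArg (fun w : EuclideanSpace ℝ (Fin 2) => w 1) h0
      simp at e0 e1
      have hm0 : m * (n₁ 0 * n₂ 1 - n₁ 1 * n₂ 0) = 0 := by
        linear_combination n₁ 0 * e1 - n₁ 1 * e0
      have hm0' := (mul_eq_zero.1 hm0).resolve_right hn
      rw [hm0'] at h0
      simp at h0
      exact hn₁ h0
    obtain ⟨y, hy, hyne⟩ := exists_inner_ne_of_affineDim_eq_two hdim hn0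
      (inner ℝ ((1 + m) • n₁ + m • n₂) c)
    have k := le_antisymm (hlow y hy) (heq ▸ hup y hy)
    rw [hfapp, hgapp, inner_sub_right, inner_sub_right] at k
    apply hyne
    simp only [inner_add_left, inner_smul_left, conj_trivial]
    linarith
  have hfp := hfpos p hp
  have hfq := hfpos q hq
  have hdet : (p - c) 0 * (q - c) 1 - (p - c) 1 * (q - c) 0 ≠ 0 := by
    intro hdet
    have hpc : p - c ≠ 0 := by
      intro h0
      rw [h0, map_zero] at hfp
      exact lt_irrefl _ hfp
    obtain ⟨a, ha⟩ := eq_smul_quarterTurn_of_inner_eq_zero (v := q - c) (quarterTurn_ne_zero hpc)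
      (by rw [inner_plane]; simp only [quarterTurn]; simp at hdet ⊢; linarith)
    have ha' : q - c = (-a) • (p - c) := by
      rw [ha, quarterTurn_quarterTurn, smul_neg, neg_smul]
    have hfe : f (q - c) = -a * f (p - c) := by rw [ha', map_smul, smul_eq_mul]
    have hge : g (q - c) = -a * g (p - c) := by rw [ha', map_smul, smul_eq_mul]
    have : (M - m) * f (q - c) = 0 := by
      linear_combination (-1 : ℝ) * hgq + hge - a * hgp - m * hfe
    rcases mul_eq_zero.1 this with h0 | h0
    · linarith
    · linarith
  obtain ⟨α, β, hαβ⟩ := exists_isCoordinates hdet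
  refine ⟨p, hVC hp, q, hVC hq, α, β, hαβ, fun y hy => ?_⟩
  have hfy : f (y - c) = α (y - c) * f (p - c) + β (y - c) * f (q - c) := by
    conv_lhs => rw [hαβ.eq_add (y - c), map_add, map_smul, map_smul, smul_eq_mul, smul_eq_mul]
  have hgy : g (y - c) = α (y - c) * g (p - c) + β (y - c) * g (q - c) := by
    conv_lhs => rw [hαβ.eq_add (y - c), map_add, map_smul, map_smul, smul_eq_mul, smul_eq_mul]
  have hl := hlow y hy
  have hu := hup y hy
  rw [hgy, hfy, hgp, hgq] at hl hu
  -- In coordinates `M f - g` is `α` times `(M - m) f (p - c)`, and `g - m f` is `β` times `(M - m)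
  -- f (q - c)`.
  constructor
  · have : 0 ≤ α (y - c) * ((M - m) * f (p - c)) := by linarith
    exact nonneg_of_mul_nonneg_left this (mul_pos (sub_pos.2 hmM) hfp)
  · have : 0 ≤ β (y - c) * ((M - m) * f (q - c)) := by linarith
    exact nonneg_of_mul_nonneg_left this (mul_pos (sub_pos.2 hmM) hfq)

/-- The zero set of an affine function that is nonnegative on `C` is a face; this one contains `c`
and `p` and lies in the line through them. -/
theorem isFacet_of_isCoordinates {C : Set (EuclideanSpace ℝ (Fin 2))} (hC : Convex ℝ C)
    (hdim : affineDim C = 2) {c p q : EuclideanSpace ℝ (Fin 2)} (hc : c ∈ C) (hp : p ∈ C)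
    {α β : EuclideanSpace ℝ (Fin 2) →L[ℝ] ℝ} (h : IsCoordinates (p - c) (q - c) α β)
    (hβ : ∀ y ∈ C, 0 ≤ β (y - c)) : IsFacet C {y ∈ C | β (y - c) = 0} := by
  have hcF : c ∈ {y ∈ C | β (y - c) = 0} := ⟨hc, by simp⟩
  have hcomb : ∀ (s t : ℝ) (a b : EuclideanSpace ℝ (Fin 2)), s + t = 1 →
      β (s • a + t • b - c) = s * β (a - c) + t * β (b - c) := by
    intro s t a b hst
    obtain rfl : t = 1 - s := by linarith
    simp
    ring
  refine ⟨⟨?_, ?_, ?_⟩, ⟨c, hcF⟩, ?_⟩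
  · rintro a ⟨ha, ha0⟩ b ⟨hb, hb0⟩ s t hs ht hst
    refine ⟨hC ha hb hs ht hst, ?_⟩
    rw [hcomb s t a b hst, ha0, hb0]
    simp
  · exact fun y hy => hy.1
  · rintro a ha b hb z ⟨hz, hz0⟩ ⟨s, t, hs, ht, hst, rfl⟩
    rw [hcomb s t a b hst] at hz0
    refine ⟨ha, ?_⟩
    have k1 := hβ a ha
    have k2 := mul_nonneg ht.le (hβ b hb)
    have k3 := mul_nonneg hs.le k1
    have : s * β (a - c) = 0 := by linarith
    exact (mul_eq_zero.1 this).resolve_left hs.ne'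
  · have hpc : p - c ≠ 0 := by
      intro h0
      have := h.fst_left
      simp [h0] at this
    have hspan : vectorSpan ℝ {y ∈ C | β (y - c) = 0} = ℝ ∙ (p - c) := by
      apply le_antisymm
      · rw [vectorSpan_def, Submodule.span_le]
        rintro _ ⟨a, ⟨-, ha⟩, b, ⟨-, hb⟩, rfl⟩
        rw [SetLike.mem_coe, Submodule.mem_span_singleton]
        refine ⟨α (a - b), ?_⟩
        have hab : β (a - b) = 0 := by
          rw [map_sub] at ha hb ⊢
          linarith
        have := h.eq_add (a - b)
        rw [hab, zero_smul, add_zero] at this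
        exact this.symm
      · rw [Submodule.span_singleton_le_iff_mem]
        exact vsub_mem_vectorSpan ℝ ⟨hp, h.snd_left⟩ hcF
    rw [hdim, affineDim, hspan, finrank_span_singleton hpc]

/-- Of the inequalities defining the triangle `c p q`, two hold on all of `C` and the third is
strict at `c`. -/
theorem isSimplicialPoint_apex {C : Set (EuclideanSpace ℝ (Fin 2))} (hC : Convex ℝ C)
    {c p q : EuclideanSpace ℝ (Fin 2)} (hc : c ∈ C) (hp : p ∈ C) (hq : q ∈ C)
    {α β : EuclideanSpace ℝ (Fin 2) →L[ℝ] ℝ} (h : IsCoordinates (p - c) (q - c) α β)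
    (hαβ : ∀ y ∈ C, 0 ≤ α (y - c) ∧ 0 ≤ β (y - c)) : IsSimplicialPoint C c := by
  refine h.isSimplicialPoint hC hc hp hq hc ?_
  have hcont : ContinuousAt (fun y => α (y - c) + β (y - c)) c := by fun_prop
  filter_upwards [self_mem_nhdsWithin, (hcont.eventually_lt_const (u := 1)
    (by simp)).filter_mono nhdsWithin_le_nhds] with y hy hy1
  exact ⟨(hαβ y hy).1, (hαβ y hy).2, hy1.le⟩

end Corner

/-! ### Interiors of flat boundary portions -/

section Flat

/-- A point in the relative interior of a flat boundary portion of a two-dimensional compact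
convex set is simplicial. -/
theorem isSimplicialPoint_of_mem_flat {C S : Set (EuclideanSpace ℝ (Fin 2))} (hC : Convex ℝ C)
    (hclosed : IsClosed C) (hdim : affineDim C = 2) (hS : IsFlatBoundaryPortion C S)
    {x : EuclideanSpace ℝ (Fin 2)} (hx : x ∈ intrinsicInterior ℝ S) : IsSimplicialPoint C x := by
  obtain ⟨a, b, hab, rfl, hfr⟩ := hS
  rw [intrinsicInterior_segment hab] at hx
  have hxfr := hfr (openSegment_subset_segment ℝ a b hx)
  have hxC : x ∈ C := hclosed.frontier_subset hxfr
  have ha : a ∈ C := hclosed.frontier_subset (hfr (left_mem_segment ℝ a b))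
  have hb : b ∈ C := hclosed.frontier_subset (hfr (right_mem_segment ℝ a b))
  obtain ⟨n, hn, hmax⟩ := hC.exists_inner_le_of_notMem_interior hxC hxfr.2
  obtain ⟨s, t, hs, ht, hst, rfl⟩ := hx
  have hna := hmax a ha
  have hnb := hmax b hb
  have hnx : inner ℝ n (s • a + t • b) = s * inner ℝ n a + t * inner ℝ n b := by
    rw [inner_add_right, inner_smul_right, inner_smul_right]
  rw [hnx] at hna hnb
  obtain rfl : s = 1 - t := by linarith
  -- A functional that is maximal at a relative interior point of the segment is constant on it.
  have hle₁ : inner ℝ n a ≤ inner ℝ n b := by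
    have : 0 ≤ t * (inner ℝ n b - inner ℝ n a) := by linarith
    linarith [nonneg_of_mul_nonneg_right this ht]
  have hle₂ : inner ℝ n b ≤ inner ℝ n a := by
    have : 0 ≤ (1 - t) * (inner ℝ n a - inner ℝ n b) := by linarith
    linarith [nonneg_of_mul_nonneg_right this hs]
  have heq := le_antisymm hle₁ hle₂
  obtain ⟨c, hc, hcne⟩ := exists_inner_ne_of_affineDim_eq_two hdim hn (inner ℝ n a)
  have hmax' : ∀ y ∈ C, inner ℝ n (y - a) ≤ 0 := by
    intro y hy
    have := hmax y hy
    rw [hnx, ← heq] at this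
    rw [inner_sub_right]
    linarith
  have hcneg : inner ℝ n (c - a) < 0 := by
    refine lt_of_le_of_ne (hmax' c hc) ?_
    rw [inner_sub_right, sub_ne_zero]
    exact hcne
  have hba : inner ℝ n (b - a) = 0 := by rw [inner_sub_right, heq, sub_self]
  have hdet : (b - a) 0 * (c - a) 1 - (b - a) 1 * (c - a) 0 ≠ 0 := by
    intro hdet
    obtain ⟨r, hr⟩ := eq_smul_quarterTurn_of_inner_eq_zero (sub_ne_zero.2 hab.symm) hba
    apply hcneg.ne
    rw [hr, inner_smul_left, inner_plane]
    simp only [quarterTurn]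
    simp at hdet ⊢
    right
    linarith
  obtain ⟨α, β, h⟩ := exists_isCoordinates hdet
  have hβ : ∀ y ∈ C, 0 ≤ β (y - a) := by
    intro y hy
    have k := hmax' y hy
    rw [h.eq_add (y - a), inner_add_right, inner_smul_right, inner_smul_right, hba] at k
    by_contra! hlt
    nlinarith [mul_pos_of_neg_of_neg hlt hcneg]
  have hxa : (1 - t) • a + t • b - a = t • (b - a) := by module
  -- At `x` only the inequality `0 ≤ β` of the triangle `a b c` is tight, and it holds on all of
  -- `C`.
  have hαx : α ((1 - t) • a + t • b - a) = t := by
    rw [hxa, map_smul, h.fst_left, smul_eq_mul, mul_one]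
  have hβx : β ((1 - t) • a + t • b - a) = 0 := by
    rw [hxa, map_smul, h.snd_left, smul_zero]
  refine h.isSimplicialPoint hC ha hb hc hxC ?_
  have c₁ : ContinuousAt (fun y => α (y - a)) ((1 - t) • a + t • b) := by fun_prop
  have c₂ : ContinuousAt (fun y => α (y - a) + β (y - a)) ((1 - t) • a + t • b) := by fun_prop
  filter_upwards [self_mem_nhdsWithin,
    (c₁.eventually_const_lt (u := 0) (by simp only [hαx]; exact ht)).filter_mono nhdsWithin_le_nhds,
    (c₂.eventually_lt_const (u := 1) (by simp only [hαx, hβx]; linarith)).filter_mono nhdsWithin_le_nhds]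
    with y hy h1 h2
  exact ⟨h1.le, hβ y hy, h2.le⟩

end Flat

/-! ### Simplicial points are not round -/

section Round

/-- Near a simplicial point, a convex set is generated by finitely many of its points. -/
theorem IsSimplicialPoint.exists_finite {C : Set (EuclideanSpace ℝ (Fin 2))} (hC : Convex ℝ C)
    {x : EuclideanSpace ℝ (Fin 2)} (h : IsSimplicialPoint C x) :
    ∃ T : Set (EuclideanSpace ℝ (Fin 2)), T.Finite ∧ T ⊆ C ∧
      ∀ n : EuclideanSpace ℝ (Fin 2), (∀ p ∈ T, inner ℝ n p ≤ inner ℝ n x) →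
        ∀ y ∈ C, inner ℝ n y ≤ inner ℝ n x := by
  obtain ⟨hx, m, k, S, hSC, hnhds⟩ := h
  -- Only the simplices through `x` matter: the others are closed and stay away from a neighborhood
  -- of `x`.
  refine ⟨⋃ j ∈ {j | x ∈ convexHull ℝ (Set.range (S j).points)}, Set.range (S j).points,
    Set.Finite.biUnion (Set.toFinite _) fun j _ => Set.finite_range _, ?_, ?_⟩
  · refine Set.iUnion₂_subset fun j _ => (subset_convexHull ℝ _).trans (hSC j)
  · intro n hn y hy
    have hclosed : ∀ j, IsClosed (convexHull ℝ (Set.range (S j).points)) := fun j =>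
      (Set.finite_range (S j).points).isClosed_convexHull ℝ
    have hfar : ∀ᶠ z in 𝓝[C] x, ∀ j, x ∉ convexHull ℝ (Set.range (S j).points) →
        z ∉ convexHull ℝ (Set.range (S j).points) := by
      rw [Filter.eventually_all]
      intro j
      by_cases hj : x ∈ convexHull ℝ (Set.range (S j).points)
      · exact Filter.Eventually.of_forall fun z h => absurd hj h
      · filter_upwards [nhdsWithin_le_nhds ((hclosed j).isOpen_compl.mem_nhds hj)] with z hz _
        exact hz
    have hlim : Filter.Tendsto (fun t : ℝ => x + t • (y - x)) (𝓝[>] 0) (𝓝[C] x) := by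
      refine tendsto_nhdsWithin_iff.2 ⟨?_, ?_⟩
      · have hc : ContinuousAt (fun t : ℝ => x + t • (y - x)) 0 := by fun_prop
        have := hc.tendsto
        simp only [zero_smul, add_zero] at this
        exact this.mono_left nhdsWithin_le_nhds
      · filter_upwards [Ioo_mem_nhdsGT (zero_lt_one' ℝ)] with t ht
        exact hC.add_smul_sub_mem hx hy ⟨ht.1.le, ht.2.le⟩
    obtain ⟨t, ⟨hU, hF⟩, ht⟩ := ((hlim.eventually (Filter.Eventually.and hnhds hfar)).and
      (self_mem_nhdsWithin (s := Set.Ioi (0 : ℝ)))).exists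
    obtain ⟨j, hj⟩ := Set.mem_iUnion.1 hU
    have hxj : x ∈ convexHull ℝ (Set.range (S j).points) := by
      by_contra hxj
      exact hF j hxj hj
    -- The half-plane contains the vertices, hence the simplex and `x + t • (y - x)`; dividing by
    -- `t` gives the bound at `y`.
    have hhalf : convexHull ℝ (Set.range (S j).points) ⊆ {z | inner ℝ n z ≤ inner ℝ n x} := by
      refine convexHull_min (fun p hp => hn p (Set.mem_iUnion₂.2 ⟨j, hxj, hp⟩)) ?_
      exact convex_halfSpace_le (innerSL ℝ n).toLinearMap.isLinear _
    have := hhalf hj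
    rw [Set.mem_ofPred_eq, inner_add_right, inner_smul_right, inner_sub_right] at this
    have h0 : t * (inner ℝ n y - inner ℝ n x) ≤ 0 := by linarith
    have := nonpos_of_mul_nonpos_right h0 ht
    linarith

theorem isSupportingLine_of_inner_le {C : Set (EuclideanSpace ℝ (Fin 2))}
    {n x : EuclideanSpace ℝ (Fin 2)} (hx : x ∈ C) (hn : n ≠ 0)
    (h : ∀ y ∈ C, inner ℝ n y ≤ inner ℝ n x) :
    IsSupportingLine C {y | inner ℝ n y = inner ℝ n x} :=
  ⟨n, _, hn, rfl, ⟨x, rfl, hx⟩, h⟩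

/-- At a point that is not a corner point, a finite set that generates the tangent cone has
elements on the supporting line in both directions. -/
theorem exists_mem_supportingLine_of_not_isCornerPoint {C T : Set (EuclideanSpace ℝ (Fin 2))}
    {x n w : EuclideanSpace ℝ (Fin 2)} (hx : x ∈ C) (hcorner : ¬ IsCornerPoint C x)
    (hT : T.Finite) (hTC : T ⊆ C)
    (hgen : ∀ n : EuclideanSpace ℝ (Fin 2), (∀ p ∈ T, inner ℝ n p ≤ inner ℝ n x) →
      ∀ y ∈ C, inner ℝ n y ≤ inner ℝ n x)
    (hn : n ≠ 0) (hmax : ∀ y ∈ C, inner ℝ n y ≤ inner ℝ n x)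
    (hw : w ≠ 0) (hnw : inner ℝ n w = 0) :
    ∃ p ∈ T, inner ℝ n (p - x) = 0 ∧ 0 < inner ℝ w (p - x) := by
  by_contra! hno
  -- Tilt the normal towards `w`: strict inequalities survive for small `ε`, and on the supporting
  -- line the negated conclusion gives the sign. The tilted line would be a second supporting line
  -- at `x`.
  have hev : ∀ᶠ ε in 𝓝[>] (0 : ℝ), ∀ p ∈ T, inner ℝ (n + ε • w) (p - x) ≤ 0 := by
    rw [Filter.eventually_all_finite hT]
    intro p hp
    have hnp : inner ℝ n (p - x) ≤ 0 := by
      rw [inner_sub_right]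
      linarith [hmax p (hTC hp)]
    rcases hnp.eq_or_lt with h0 | hlt
    · filter_upwards [self_mem_nhdsWithin] with ε hε
      rw [inner_add_left, inner_smul_left, h0, zero_add]
      exact mul_nonpos_of_nonneg_of_nonpos (le_of_lt hε) (hno p hp h0)
    · have hc : ContinuousAt (fun ε : ℝ => inner ℝ (n + ε • w) (p - x)) 0 := by fun_prop
      exact ((hc.eventually_lt_const (u := 0) (by simpa using hlt)).filter_mono
        nhdsWithin_le_nhds).mono fun ε h => h.le
  obtain ⟨ε, hε, hε0⟩ := (hev.and (self_mem_nhdsWithin (s := Set.Ioi (0 : ℝ)))).exists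
  have hmax' := hgen (n + ε • w) fun p hp => by
    have := hε p hp
    rw [inner_sub_right] at this
    linarith
  have hne : n + ε • w ≠ 0 := by
    intro h0
    have := congrArg (inner ℝ n) h0
    rw [inner_add_right, inner_smul_right, hnw, mul_zero, add_zero, inner_zero_right,
      inner_self_eq_zero] at this
    exact hn this
  refine hcorner ⟨hx, _, _, isSupportingLine_of_inner_le hx hn hmax,
    isSupportingLine_of_inner_le hx hne hmax', rfl, rfl, fun heq => ?_⟩
  have hmem : x + w ∈ {y | inner ℝ n y = inner ℝ n x} := by
    rw [Set.mem_ofPred_eq, inner_add_right, hnw, add_zero]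
  rw [heq, Set.mem_ofPred_eq, inner_add_right (n + ε • w), inner_add_left _ _ w, hnw,
    inner_smul_left] at hmem
  have : ε * inner ℝ w w = 0 := by simpa using hmem
  rcases mul_eq_zero.1 this with h0 | h0
  · exact (ne_of_gt hε0) h0
  · exact hw (inner_self_eq_zero.1 h0)

theorem not_isRoundBoundaryPoint_of_isSimplicialPoint {C : Set (EuclideanSpace ℝ (Fin 2))}
    (hC : Convex ℝ C) {x : EuclideanSpace ℝ (Fin 2)} (h : IsSimplicialPoint C x) :
    ¬ IsRoundBoundaryPoint C x := by
  rintro ⟨hfr, hcorner, hflat⟩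
  have hx := h.1
  obtain ⟨T, hT, hTC, hgen⟩ := h.exists_finite hC
  obtain ⟨n, hn, hmax⟩ := hC.exists_inner_le_of_notMem_interior hx hfr.2
  set w := quarterTurn n with hwdef
  have hw : w ≠ 0 := quarterTurn_ne_zero hn
  have hnw : inner ℝ n w = 0 := by rw [real_inner_comm]; exact inner_quarterTurn_self n
  obtain ⟨p, hp, hp0, hpw⟩ :=
    exists_mem_supportingLine_of_not_isCornerPoint hx hcorner hT hTC hgen hn hmax hw hnw
  obtain ⟨q, hq, hq0, hqw⟩ :=
    exists_mem_supportingLine_of_not_isCornerPoint hx hcorner hT hTC hgen hn hmax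
      (neg_ne_zero.2 hw) (by rw [inner_neg_right, hnw, neg_zero])
  obtain ⟨a, ha⟩ := eq_smul_quarterTurn_of_inner_eq_zero hn ((real_inner_comm _ _).trans hp0)
  obtain ⟨b, hb⟩ := eq_smul_quarterTurn_of_inner_eq_zero hn ((real_inner_comm _ _).trans hq0)
  rw [← hwdef] at ha hb
  have hww := real_inner_self_pos.2 hw
  have ha0 : 0 < a := by
    rw [ha, inner_smul_right] at hpw
    exact (pos_iff_pos_of_mul_pos hpw).2 hww
  have hb0 : b < 0 := by
    rw [hb, inner_smul_right, inner_neg_left] at hqw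
    nlinarith
  have hpe : p = x + a • w := by rw [← ha]; abel
  have hqe : q = x + b • w := by rw [← hb]; abel
  have hpq : p ≠ q := by
    rintro rfl
    rw [hb] at ha
    have := smul_left_injective ℝ hw ha
    linarith
  have hab : 0 < a - b := by linarith
  refine hflat ⟨segment ℝ p q, ⟨p, q, hpq, rfl, ?_⟩, ?_⟩
  · intro y hy
    refine ⟨subset_closure (hC.segment_subset (hTC hp) (hTC hq) hy), ?_⟩
    have hny : inner ℝ n y = inner ℝ n x := by
      obtain ⟨s, t, -, -, hst, rfl⟩ := hy
      rw [inner_sub_right, sub_eq_zero] at hp0 hq0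
      rw [inner_add_right, inner_smul_right, inner_smul_right, hp0, hq0, ← add_mul, hst, one_mul]
    exact notMem_interior_of_inner_le hn (by rw [hny]; exact hmax)
  · rw [intrinsicInterior_segment hpq]
    -- The weights that express `x` through `x + a • w` and `x + b • w`, where `b < 0 < a`.
    refine ⟨-b / (a - b), a / (a - b), div_pos (by linarith) hab, div_pos ha0 hab, ?_, ?_⟩
    · field_simp
      ring
    · rw [hpe, hqe]
      match_scalars <;> field_simp <;> ring

end Round

/-! ### The main theorem -/

theorem mainTheorem10 {d : ℕ} (u₁ u₂ : Matrix (Fin d) (Fin d) ℂ)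
    (hu₁ : u₁.IsHermitian) (hu₂ : u₂.IsHermitian) :
    (affineDim (jointNumericalRange ![u₁, u₂]) = 2 →
      ∀ x, IsCornerPoint (jointNumericalRange ![u₁, u₂]) x →
        ∃ F₁ F₂ : Set (EuclideanSpace ℝ (Fin 2)),
          IsFacet (jointNumericalRange ![u₁, u₂]) F₁ ∧
          IsFacet (jointNumericalRange ![u₁, u₂]) F₂ ∧ F₁ ≠ F₂ ∧ F₁ ∩ F₂ = {x}) ∧
    (∀ x ∈ jointNumericalRange ![u₁, u₂],
      (IsRoundBoundaryPoint (jointNumericalRange ![u₁, u₂]) x ∨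
        IsSimplicialPoint (jointNumericalRange ![u₁, u₂]) x) ∧
      ¬ (IsRoundBoundaryPoint (jointNumericalRange ![u₁, u₂]) x ∧
        IsSimplicialPoint (jointNumericalRange ![u₁, u₂]) x)) := by
  have hu : ∀ i, (![u₁, u₂] i).IsHermitian := by
    intro i
    fin_cases i
    · exact hu₁
    · exact hu₂
  rw [jointNumericalRange_eq_operatorNumericalRange hu]
  set A := fun i => Matrix.toEuclideanCLM (𝕜 := ℂ) (![u₁, u₂] i)
  have hA : ∀ i, IsSelfAdjoint (A i) := fun i =>
    IsSelfAdjoint.map (hu i) (Matrix.toEuclideanCLM (𝕜 := ℂ))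
  have hconv := convex_operatorNumericalRange hA
  have hcomp := isCompact_operatorNumericalRange A
  have hcorner : affineDim (operatorNumericalRange A) = 2 →
      ∀ x, IsCornerPoint (operatorNumericalRange A) x →
        ∃ p ∈ operatorNumericalRange A, ∃ q ∈ operatorNumericalRange A, ∃ α β,
          IsCoordinates (p - x) (q - x) α β ∧
            ∀ y ∈ operatorNumericalRange A, 0 ≤ α (y - x) ∧ 0 ≤ β (y - x) := by
    intro hdim x hx
    obtain ⟨n₁, n₂, hn, h₁, h₂⟩ := hx.exists_support
    obtain ⟨V, hVC, hV, hxV, hcone⟩ := exists_isCompact_cone_of_corner hA hn h₁ h₂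
    exact exists_isCoordinates_of_cone hdim hn h₁ h₂ hVC hV hxV hcone
  refine ⟨fun hdim x hx => ?_, fun x hx => ⟨?_, fun h =>
    not_isRoundBoundaryPoint_of_isSimplicialPoint hconv h.2 h.1⟩⟩
  · obtain ⟨p, hp, q, hq, α, β, h, hpos⟩ := hcorner hdim x hx
    refine ⟨_, _, isFacet_of_isCoordinates hconv hdim hx.1 hp h fun y hy => (hpos y hy).2,
      isFacet_of_isCoordinates hconv hdim hx.1 hq h.swap fun y hy => (hpos y hy).1, ?_, ?_⟩
    -- The point `p` separates the facets: `β (p - x) = 0` but `α (p - x) = 1`.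
    · intro heq
      have hmem := heq.subset ⟨hp, h.snd_left⟩
      have := hmem.2.symm.trans h.fst_left
      exact zero_ne_one this
    · ext y
      constructor
      · rintro ⟨⟨-, hβ⟩, -, hα⟩
        have := h.eq_add (y - x)
        rw [hα, hβ, zero_smul, zero_smul, add_zero, sub_eq_zero] at this
        exact this
      · rintro rfl
        exact ⟨⟨hx.1, by simp⟩, hx.1, by simp⟩
  · rw [or_iff_not_imp_left]
    intro hround
    by_cases hdim : affineDim (operatorNumericalRange A) = 2
    · by_cases hint : x ∈ interior (operatorNumericalRange A)
      · exact isSimplicialPoint_of_mem_interior hconv hint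
      by_cases hc : IsCornerPoint (operatorNumericalRange A) x
      · obtain ⟨p, hp, q, hq, α, β, h, hpos⟩ := hcorner hdim x hc
        exact isSimplicialPoint_apex hconv hx hp hq h hpos
      by_contra hsimp
      refine hround ⟨⟨subset_closure hx, hint⟩, hc, ?_⟩
      rintro ⟨S, hS, hxS⟩
      exact hsimp (isSimplicialPoint_of_mem_flat hconv hcomp.isClosed hdim hS hxS)
    · refine isSimplicialPoint_of_affineDim_le_one hconv hcomp ?_ hx
      have : affineDim (operatorNumericalRange A) ≤ 2 := by
        have := Submodule.finrank_le (vectorSpan ℝ (operatorNumericalRange A))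
        rwa [finrank_euclideanSpace_fin] at this
      omega
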